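/- Let $c_1>0$. There is a function $C:(0,\infty)\to\mathbb{R}$, depending only on $c_1$, such that the following holds for all integers $n\ge 1$ and $l\ge c_1\,n\log^2 n$ (natural logarithm). There is an algorithm, namely a finite program which receives $3l$ real inputs, branches on sign tests of polynomials with rational coefficients in the inputs, and outputs the value of such a polynomial, for which the following is true for every $c>0$, every $\alpha>0$ and every $(c,\alpha)$-mixed Hölder function $f:[0,1]^2\to\mathbb{R}$, that is, every $f$ with $$|f(x',y)-f(x,y)|\le c|x'-x|^\alpha,\qquad |f(x,y')-f(x,y)|\le c|y'-y|^\alpha,$$ $$|f(x',y')-f(x,y')-f(x',y)+f(x,y)|\le c\,(|x'-x||y'-y|)^\alpha$$ for all $x,x',y,y'\in[0,1]$. The function $f$ is integrable on $[0,1]^2$, and if $X_1,\ldots,X_l$ are independent and uniformly distributed on $[0,1]^2$, and $I$ denotes the output of the algorithm on the locations $X_1,\ldots,X_l$ and the values $f(X_1),\ldots,f(X_l)$, then $$\left|\int_{[0,1]^2} f(x)\,dx - I\right|\le C(c)\, n^{-\alpha}\log^{3/2} n$$ with probability at least $1-n^{2-c_1}$. (Thus the implied constant depends only on $c$ and $c_1$,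 and the algorithm knows neither $f$ nor $c$ nor $\alpha$.) -/

import Mathlib

open MeasureTheory ProbabilityTheory

/-- The unit square `[0,1]²`. -/
def unitSquare : Set (ℝ × ℝ) := Set.Icc 0 1 ×ˢ Set.Icc 0 1

/-- `f` is `(c, α)`-mixed Hölder on the unit square; values of `f` off the square play no role. -/
structure MixedHolder (c α : ℝ) (f : ℝ × ℝ → ℝ) : Prop where
  fst : ∀ x ∈ Set.Icc (0 : ℝ) 1, ∀ x' ∈ Set.Icc (0 : ℝ) 1, ∀ y ∈ Set.Icc (0 : ℝ) 1,
    |f (x', y) - f (x, y)| ≤ c * |x' - x| ^ α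
  snd : ∀ x ∈ Set.Icc (0 : ℝ) 1, ∀ y ∈ Set.Icc (0 : ℝ) 1, ∀ y' ∈ Set.Icc (0 : ℝ) 1,
    |f (x, y') - f (x, y)| ≤ c * |y' - y| ^ α
  mixed : ∀ x ∈ Set.Icc (0 : ℝ) 1, ∀ x' ∈ Set.Icc (0 : ℝ) 1,
    ∀ y ∈ Set.Icc (0 : ℝ) 1, ∀ y' ∈ Set.Icc (0 : ℝ) 1,
    |f (x', y') - f (x, y') - f (x', y) + f (x, y)| ≤ c * (|x' - x| * |y' - y|) ^ α

/-- An algebraic decision tree with real inputs indexed by `ι`: a finite program that branches on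
sign tests of polynomial expressions with rational coefficients in the inputs, and finally outputs
such an expression. -/
inductive DecisionTree (ι : Type) : Type
  | output (p : MvPolynomial ι ℚ) : DecisionTree ι
  | test (p : MvPolynomial ι ℚ) (nonneg neg : DecisionTree ι) : DecisionTree ι

open Classical in
/-- The real number that a decision tree outputs on the input `a`. -/
noncomputable def DecisionTree.eval {ι : Type} (a : ι → ℝ) : DecisionTree ι → ℝ
  | .output p => MvPolynomial.aeval a p
  | .test p s t => if 0 ≤ (MvPolynomial.aeval a p : ℝ) then s.eval a else t.eval a

/-- The data available to the algorithm: for each sample point its two coordinates and the value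
of `f` there. -/
def sampleData {l : ℕ} (f : ℝ × ℝ → ℝ) (x : Fin l → ℝ × ℝ) : Fin l × Fin 3 → ℝ :=
  fun q => ![(x q.1).1, (x q.1).2, f (x q.1)] q.2

/-! Take `m = Nat.log 2 n` and the space V of functions on the `2 ^ m × 2 ^ m` grid spanned by
indicators of dyadic rectangles of area `2 ^ (-m)`. A mixed Hölder `f` is within `η = (m + 2) * c *
2 ^ (-m * α)` of some `h` in V, its sparse grid approximation
(`MixedHolder.abs_sub_hyperbolicApprox_le`). V has a reproducing kernel with constant diagonal `D =
2 ^ m * (1 + m / 2)`, of order `n log n`.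

The algorithm recovers `h` by a randomized Kaczmarz iteration: it starts from a constant and
corrects the current function along `K · ξ` at each sample. This is an orthogonal projection, so
with exact data the squared error drops by `u ξ ^ 2 / D`, and averaging over a uniform `ξ` gives the
factor `1 - 1 / D` (`sum_meanSq_kaczmarz`). Data wrong by at most `η` add at most `η ^ 2 / D` per
step (`meanSq_kaczmarz_le`). By linearity the two effects separate
(`abs_setIntegral_sub_kaczmarzMean_le`).

With about `c₁ n log² n` steps the initial error contracts by a factor of order `n ^ (-c₁)`, and
Markov's inequality gives the probability `1 - n ^ (2 - c₁)`. The accumulated noise is of order `η *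
√(log n)`, which is where `log ^ (3 / 2)` comes from. Once the cells of the samples are known, the
output is a rational linear form in the values of `f`, so a decision tree can compute it without
knowing `f`, `c` or `α`. -/

/-! ### The Kaczmarz iteration for a reproducing kernel with constant diagonal. -/

section Kaczmarz

/-- One step of the Kaczmarz iteration: `g` is corrected by a multiple of `K · ξ` such that its
value at `ξ` becomes `w`. -/
def kaczmarzStep {G R : Type*} [CommRing R] [Algebra ℚ R] (K : G → G → ℚ) (g : G → R) (ξ : G)
    (w : R) : G → R :=
  fun x => g x + (K x ξ / K ξ ξ) • (w - g ξ)

/-- The Kaczmarz iteration started at `g`, run through the points `ξ` with the data `w`. -/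
def kaczmarz {G R : Type*} [CommRing R] [Algebra ℚ R] (K : G → G → ℚ) :
    ∀ k : ℕ, (G → R) → (Fin k → G) → (Fin k → R) → G → R
  | 0, g, _, _ => g
  | k + 1, g, ξ, w =>
      kaczmarz K k (kaczmarzStep K g (ξ 0) (w 0)) (fun i => ξ i.succ) (fun i => w i.succ)

/-- The mean square of a function on a finite type. -/
noncomputable def meanSq {G : Type*} [Fintype G] (u : G → ℝ) : ℝ :=
  (∑ x, u x ^ 2) / Fintype.card G

/-- `u` is reproduced by integration against the kernel `K`, for the uniform probability. -/
def Reproduces {G : Type*} [Fintype G] (K : G → G → ℚ) (u : G → ℝ) : Prop :=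
  ∀ x, ∑ y, (K x y : ℝ) * u y = Fintype.card G * u x

/-- A symmetric kernel with constant diagonal `D` that reproduces its sections and constants. -/
structure IsHomogeneousKernel {G : Type*} [Fintype G] (K : G → G → ℚ) (D : ℚ) : Prop where
  symm : ∀ x y, K x y = K y x
  diag : ∀ x, K x x = D
  one_le : 1 ≤ D
  section_reproduces : ∀ y, Reproduces K (fun x => (K x y : ℝ))
  const_reproduces : ∀ a : ℝ, Reproduces K (fun _ => a)

section Generic

variable {G R S : Type*} [CommRing R] [Algebra ℚ R] [CommRing S] [Algebra ℚ S] (K : G → G → ℚ)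

/-- Lets the iteration run on formal polynomials in the data and be evaluated afterwards; this is
why `kaczmarz` is defined over any `ℚ`-algebra. -/
theorem kaczmarz_map (φ : R →ₐ[ℚ] S) (k : ℕ) (g : G → R) (ξ : Fin k → G) (w : Fin k → R) (x : G) :
    φ (kaczmarz K k g ξ w x) = kaczmarz K k (fun y => φ (g y)) ξ (fun i => φ (w i)) x := by
  induction k generalizing g with
  | zero => rfl
  | succ k ih =>
    simp only [kaczmarz]
    rw [ih]
    congr 1
    funext y
    simp [kaczmarzStep]

theorem kaczmarz_add (k : ℕ) (g g' : G → R) (ξ : Fin k → G) (w w' : Fin k → R) :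
    kaczmarz K k (g + g') ξ (w + w') = kaczmarz K k g ξ w + kaczmarz K k g' ξ w' := by
  induction k generalizing g g' with
  | zero => rfl
  | succ k ih =>
    simp only [kaczmarz]
    rw [← ih]
    congr 1
    funext y
    simp only [kaczmarzStep, Pi.add_apply]
    rw [show w 0 + w' 0 - (g (ξ 0) + g' (ξ 0)) = (w 0 - g (ξ 0)) + (w' 0 - g' (ξ 0)) by ring,
      smul_add]
    ring

theorem kaczmarz_exact_data (k : ℕ) (h : G → R) (ξ : Fin k → G) :
    kaczmarz K k h ξ (fun i => h (ξ i)) = h := by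
  induction k with
  | zero => rfl
  | succ k ih =>
    simp only [kaczmarz]
    have : kaczmarzStep K h (ξ 0) (h (ξ 0)) = h := by
      funext y; simp [kaczmarzStep]
    rw [this]
    exact ih _

end Generic

variable {G : Type*} [Fintype G] {K : G → G → ℚ}

theorem Reproduces.add {u v : G → ℝ} (hu : Reproduces K u) (hv : Reproduces K v) :
    Reproduces K (fun x => u x + v x) := by
  intro x
  simp only [mul_add, Finset.sum_add_distrib]
  rw [hu x, hv x]

theorem Reproduces.const_mul {u : G → ℝ} (a : ℝ) (hu : Reproduces K u) :
    Reproduces K (fun x => a * u x) := by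
  intro x
  simp only [mul_left_comm _ a, ← Finset.mul_sum]
  rw [hu x]

theorem Reproduces.sub {u v : G → ℝ} (hu : Reproduces K u) (hv : Reproduces K v) :
    Reproduces K (fun x => u x - v x) := by
  intro x
  simp only [mul_sub, Finset.sum_sub_distrib]
  rw [hu x, hv x]

theorem Reproduces.sum {ι : Type*} {s : Finset ι} {u : ι → G → ℝ}
    (hu : ∀ i ∈ s, Reproduces K (u i)) : Reproduces K (fun x => ∑ i ∈ s, u i x) := by
  intro x
  simp only [Finset.mul_sum]
  rw [Finset.sum_comm]
  exact Finset.sum_congr rfl fun i hi => hu i hi x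

theorem meanSq_nonneg (u : G → ℝ) : 0 ≤ meanSq u := by unfold meanSq; positivity

theorem abs_mean_le_sqrt_meanSq (u : G → ℝ) :
    |(∑ x, u x) / Fintype.card G| ≤ √(meanSq u) := by
  apply Real.abs_le_sqrt
  unfold meanSq
  rcases Nat.eq_zero_or_pos (Fintype.card G) with h | h
  · simp [h]
  have h' : (0 : ℝ) < Fintype.card G := by exact_mod_cast h
  have := sq_sum_le_card_mul_sum_sq (s := Finset.univ) (f := u)
  rw [Finset.card_univ] at this
  rw [div_pow, div_le_div_iff₀ (by positivity) h']
  nlinarith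

theorem meanSq_le_of_abs_le [Nonempty G] {u : G → ℝ} {b : ℝ} (h : ∀ x, |u x| ≤ b) :
    meanSq u ≤ b ^ 2 := by
  unfold meanSq
  have h' : (0 : ℝ) < Fintype.card G := by exact_mod_cast Fintype.card_pos
  rw [div_le_iff₀ h']
  calc ∑ x, u x ^ 2 ≤ ∑ _x : G, b ^ 2 := Finset.sum_le_sum fun x _ => by
        rw [← sq_abs]; exact pow_le_pow_left₀ (abs_nonneg _) (h x) 2
    _ = _ := by simp; ring

variable {D : ℚ}

theorem kaczmarzStep_reproduces (hK : IsHomogeneousKernel K D) {u : G → ℝ} (hu : Reproduces K u)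
    (ξ : G) (w : ℝ) : Reproduces K (kaczmarzStep K u ξ w) := by
  have := hu.add ((hK.section_reproduces ξ).const_mul ((w - u ξ) / (K ξ ξ : ℝ)))
  convert this using 2 with x
  simp only [kaczmarzStep, Rat.smul_def, Rat.cast_div]
  ring

/-- Pythagoras: by the reproducing property, `K · ξ` has squared norm `D` and inner product `u ξ`
with `u`. -/
theorem meanSq_kaczmarzStep [Nonempty G] (hK : IsHomogeneousKernel K D) {u : G → ℝ}
    (hu : Reproduces K u) (ξ : G) (w : ℝ) :
    meanSq (kaczmarzStep K u ξ w) = meanSq u + (w ^ 2 - u ξ ^ 2) / D := by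
  have h' : (0 : ℝ) < Fintype.card G := by exact_mod_cast Fintype.card_pos
  have hD : (0 : ℝ) < D := by exact_mod_cast lt_of_lt_of_le one_pos hK.one_le
  have e1 := hu ξ
  have e2 := hK.section_reproduces ξ ξ
  simp only [hK.diag] at e2
  have e3 : ∑ x, kaczmarzStep K u ξ w x ^ 2 = ∑ x, u x ^ 2
      + 2 * ((w - u ξ) / D) * ∑ x, (K ξ x : ℝ) * u x
      + ((w - u ξ) / D) ^ 2 * ∑ x, (K ξ x : ℝ) * K x ξ := by
    rw [Finset.mul_sum, Finset.mul_sum, ← Finset.sum_add_distrib, ← Finset.sum_add_distrib]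
    refine Finset.sum_congr rfl fun x _ => ?_
    simp only [kaczmarzStep, Rat.smul_def, Rat.cast_div, hK.diag, hK.symm ξ x]
    ring
  unfold meanSq
  rw [e3, e1, e2]
  field_simp
  ring

/-- Stability under noise, for every choice of points: by `meanSq_kaczmarzStep` a step raises the
mean square by at most `η ^ 2 / D`. -/
theorem meanSq_kaczmarz_le [Nonempty G] (hK : IsHomogeneousKernel K D) {η : ℝ} (k : ℕ)
    {v : G → ℝ} (hv : Reproduces K v) (ξ : Fin k → G) (w : Fin k → ℝ) (hw : ∀ i, |w i| ≤ η) :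
    meanSq (kaczmarz K k v ξ w) ≤ meanSq v + k * η ^ 2 / D := by
  have hD : (0 : ℝ) < D := by exact_mod_cast lt_of_lt_of_le one_pos hK.one_le
  induction k generalizing v with
  | zero => simp [kaczmarz]
  | succ k ih =>
    simp only [kaczmarz]
    refine (ih (kaczmarzStep_reproduces hK hv _ _) _ _ fun i => hw _).trans ?_
    rw [meanSq_kaczmarzStep hK hv]
    have h1 : w 0 ^ 2 ≤ η ^ 2 := by
      rw [← sq_abs]; exact pow_le_pow_left₀ (abs_nonneg _) (hw 0) 2
    have h2 : (w 0 ^ 2 - v (ξ 0) ^ 2) / D ≤ η ^ 2 / D := by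
      gcongr; nlinarith [sq_nonneg (v (ξ 0))]
    push_cast
    rw [add_mul, add_div, one_mul]
    linarith

/-- The expected contraction, written as a sum over all point sequences. Summing `u x ^ 2 / D` over
the first point gives exactly `1 / D` of the total because the diagonal is constant. -/
theorem sum_meanSq_kaczmarz [Nonempty G] (hK : IsHomogeneousKernel K D) (k : ℕ)
    {u : G → ℝ} (hu : Reproduces K u) :
    ∑ ξ : Fin k → G, meanSq (kaczmarz K k u ξ (fun _ => 0)) =
      (Fintype.card G * (1 - 1 / (D : ℝ))) ^ k * meanSq u := by
  have h' : (0 : ℝ) < Fintype.card G := by exact_mod_cast Fintype.card_pos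
  induction k generalizing u with
  | zero => simp [kaczmarz]
  | succ k ih =>
    rw [← (Fin.consEquiv fun _ => G).sum_comp, Fintype.sum_prod_type]
    have e : ∀ x : G, ∑ y : Fin k → G,
        meanSq (kaczmarz K (k + 1) u ((Fin.consEquiv fun _ => G) (x, y)) fun _ => 0)
        = (Fintype.card G * (1 - 1 / (D : ℝ))) ^ k * (meanSq u - u x ^ 2 / D) := by
      intro x
      rw [show meanSq u - u x ^ 2 / D = meanSq (kaczmarzStep K u x 0) by
        rw [meanSq_kaczmarzStep hK hu]; ring]
      rw [← ih (kaczmarzStep_reproduces hK hu x 0)]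
      rfl
    simp only [e]
    rw [← Finset.mul_sum, Finset.sum_sub_distrib, ← Finset.sum_div,
      show ∑ x, u x ^ 2 = Fintype.card G * meanSq u by unfold meanSq; field_simp]
    simp only [Finset.sum_const, Finset.card_univ, nsmul_eq_mul]
    ring

end Kaczmarz

/-! ### The reproducing kernel of the span of dyadic rectangles. -/

section HyperbolicKernel

/-- The kernel of averaging over the dyadic intervals of level `j` in a grid of `2 ^ m` cells. -/
def averagingKernel (m j : ℕ) (x y : Fin (2 ^ m)) : ℚ :=
  if (x : ℕ) / 2 ^ (m - j) = (y : ℕ) / 2 ^ (m - j) then 2 ^ j else 0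

/-- The kernel of the projection onto the Haar functions of level `j`. -/
def haarKernel (m : ℕ) : ℕ → Fin (2 ^ m) → Fin (2 ^ m) → ℚ
  | 0, x, y => averagingKernel m 0 x y
  | j + 1, x, y => averagingKernel m (j + 1) x y - averagingKernel m j x y

/-- The kernel of the projection onto the span of the indicators of the dyadic rectangles of
area `2 ^ (-m)`. -/
def hyperbolicKernel (m : ℕ) (x y : Fin (2 ^ m) × Fin (2 ^ m)) : ℚ :=
  ∑ j ∈ Finset.range (m + 1), haarKernel m j x.1 y.1 * averagingKernel m (m - j) x.2 y.2

/-- `p` is constant on the dyadic intervals of level `j`. -/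
def ConstantAtLevel {A : Type*} (m j : ℕ) (p : Fin (2 ^ m) → A) : Prop :=
  ∀ x y : Fin (2 ^ m), (x : ℕ) / 2 ^ (m - j) = (y : ℕ) / 2 ^ (m - j) → p x = p y

theorem ConstantAtLevel.mono {A : Type*} {m i j : ℕ} (hij : i ≤ j)
    {p : Fin (2 ^ m) → A} (hp : ConstantAtLevel m i p) : ConstantAtLevel m j p := by
  intro x y h
  apply hp
  rw [show m - i = (m - j) + (m - i - (m - j)) by omega, pow_add, ← Nat.div_div_eq_div_mul,
    ← Nat.div_div_eq_div_mul, h]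

theorem card_dyadic_interval {m j : ℕ} (hj : j ≤ m) (x : Fin (2 ^ m)) :
    (Finset.univ.filter fun y : Fin (2 ^ m) =>
      (x : ℕ) / 2 ^ (m - j) = (y : ℕ) / 2 ^ (m - j)).card = 2 ^ (m - j) := by
  set b := 2 ^ (m - j) with hb
  have hb0 : 0 < b := by positivity
  have hm : 2 ^ m = b * 2 ^ j := by rw [hb, ← pow_add]; congr 1; omega
  have hx : (x : ℕ) / b < 2 ^ j := by
    rw [Nat.div_lt_iff_lt_mul hb0, mul_comm, ← hm]; exact x.2
  have e : (Finset.univ.filter fun y : Fin (2 ^ m) => (x : ℕ) / b = (y : ℕ) / b).map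
      Fin.valEmbedding = Finset.Ico ((x : ℕ) / b * b) ((x : ℕ) / b * b + b) := by
    ext z
    simp only [Finset.mem_map, Finset.mem_filter, Finset.mem_univ, true_and, Finset.mem_Ico,
      Fin.valEmbedding_apply]
    constructor
    · rintro ⟨y, hy, rfl⟩
      rw [hy]
      exact ⟨Nat.div_mul_le_self _ _, Nat.lt_div_mul_add hb0⟩
    · rintro ⟨h1, h2⟩
      have hz : z / b = (x : ℕ) / b := by
        rw [Nat.div_eq_iff hb0]; constructor <;> omega
      refine ⟨⟨z, ?_⟩, hz.symm, rfl⟩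
      rw [hm]
      calc z < ((x : ℕ) / b + 1) * b := by rw [add_mul]; omega
        _ ≤ 2 ^ j * b := Nat.mul_le_mul_right _ hx
        _ = _ := mul_comm _ _
  rw [← Finset.card_map Fin.valEmbedding, e]
  simp

theorem sum_averagingKernel_mul {m i j : ℕ} (hij : i ≤ j) (hj : j ≤ m) {p : Fin (2 ^ m) → ℝ}
    (hp : ConstantAtLevel m i p) (x : Fin (2 ^ m)) :
    ∑ y, (averagingKernel m j x y : ℝ) * p y = 2 ^ m * p x := by
  have hp' := hp.mono hij
  have : ∀ y, (averagingKernel m j x y : ℝ) * p y =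
      if (x : ℕ) / 2 ^ (m - j) = (y : ℕ) / 2 ^ (m - j) then 2 ^ j * p x else 0 := by
    intro y
    unfold averagingKernel
    split_ifs with h
    · rw [hp' x y h]; push_cast; rfl
    · simp
  simp only [this]
  rw [← Finset.sum_filter, Finset.sum_const, card_dyadic_interval hj, nsmul_eq_mul]
  push_cast
  rw [← mul_assoc, ← pow_add, Nat.sub_add_cancel hj]

theorem sum_haarKernel_mul_eq_zero {m i j : ℕ} (hij : i < j) (hj : j ≤ m) {p : Fin (2 ^ m) → ℝ}
    (hp : ConstantAtLevel m i p) (x : Fin (2 ^ m)) :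
    ∑ y, (haarKernel m j x y : ℝ) * p y = 0 := by
  obtain ⟨j, rfl⟩ : ∃ j', j = j' + 1 := ⟨j - 1, by omega⟩
  simp only [haarKernel, Rat.cast_sub, sub_mul, Finset.sum_sub_distrib]
  rw [sum_averagingKernel_mul (by omega) hj hp, sum_averagingKernel_mul (by omega) (by omega) hp,
    sub_self]

theorem sum_haarKernel (m i : ℕ) (x y : Fin (2 ^ m)) :
    ∑ j ∈ Finset.range (i + 1), haarKernel m j x y = averagingKernel m i x y := by
  induction i with
  | zero => simp [haarKernel]
  | succ i ih => rw [Finset.sum_range_succ, ih]; simp [haarKernel]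

/-- The Haar kernels of levels `0, …, m` sum to the identity kernel in the first variable, so it
suffices that each term of `hyperbolicKernel` acts on `u` as its Haar factor alone. -/
theorem hyperbolicKernel_reproduces {m i : ℕ} (hi : i ≤ m) {u : Fin (2 ^ m) × Fin (2 ^ m) → ℝ}
    (h1 : ∀ b, ConstantAtLevel m i fun a => u (a, b))
    (h2 : ∀ a, ConstantAtLevel m (m - i) fun b => u (a, b)) :
    Reproduces (hyperbolicKernel m) u := by
  rintro ⟨a, b⟩
  have key : ∀ j ∈ Finset.range (m + 1),
      ∑ y : Fin (2 ^ m) × Fin (2 ^ m),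
        (haarKernel m j a y.1 : ℝ) * (averagingKernel m (m - j) b y.2 : ℝ) * u y
      = ∑ a', (haarKernel m j a a' : ℝ) * (2 ^ m * u (a', b)) := by
    intro j hj
    rw [Finset.mem_range] at hj
    rw [Fintype.sum_prod_type]
    -- For `j ≤ i`, level `m - j` is at least as fine as `m - i`, so averaging in the second
    -- variable fixes `u`. For `j > i` the Haar factor annihilates both sides.
    rcases le_or_gt j i with hji | hji
    · refine Finset.sum_congr rfl fun a' _ => ?_
      simp only [mul_assoc, ← Finset.mul_sum]
      rw [sum_averagingKernel_mul (by omega) (by omega) (h2 a')]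
    · rw [Finset.sum_comm]
      simp only [mul_right_comm _ (averagingKernel m (m - j) b _ : ℝ), ← Finset.sum_mul]
      simp only [sum_haarKernel_mul_eq_zero hji (by omega) (h1 _)]
      simp only [mul_left_comm _ ((2 : ℝ) ^ m), ← Finset.mul_sum]
      rw [sum_haarKernel_mul_eq_zero hji (by omega) (h1 b)]
      simp
  simp only [hyperbolicKernel, Rat.cast_sum, Rat.cast_mul, Finset.sum_mul]
  rw [Finset.sum_comm, Finset.sum_congr rfl key, Finset.sum_comm]
  simp only [← Finset.sum_mul, ← Rat.cast_sum, sum_haarKernel]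
  simp only [mul_left_comm _ ((2 : ℝ) ^ m), ← Finset.mul_sum]
  rw [sum_averagingKernel_mul hi le_rfl (h1 b)]
  simp
  ring

theorem averagingKernel_symm (m j : ℕ) (x y : Fin (2 ^ m)) :
    averagingKernel m j x y = averagingKernel m j y x := by
  simp [averagingKernel, eq_comm]

theorem haarKernel_symm (m j : ℕ) (x y : Fin (2 ^ m)) :
    haarKernel m j x y = haarKernel m j y x := by
  cases j <;> simp [haarKernel, averagingKernel_symm m _ x y]

theorem averagingKernel_constantAtLevel (m j : ℕ) (y : Fin (2 ^ m)) :
    ConstantAtLevel m j fun x => averagingKernel m j x y := by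
  intro x x' h
  simp [averagingKernel, h]

theorem haarKernel_constantAtLevel (m j : ℕ) (y : Fin (2 ^ m)) :
    ConstantAtLevel m j fun x => haarKernel m j x y := by
  intro x x' h
  cases j with
  | zero => exact averagingKernel_constantAtLevel m 0 y x x' h
  | succ j =>
    have h1 := averagingKernel_constantAtLevel m (j + 1) y x x' h
    have h2 := (averagingKernel_constantAtLevel m j y).mono (Nat.le_succ j) x x' h
    simp only at h1 h2
    simp only [haarKernel, h1, h2]

/-- Level `0` contributes `2 ^ m`; each of the other `m` levels contributes `2 ^ j * 2 ^ (m - j - 1)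
= 2 ^ m / 2`. -/
theorem hyperbolicKernel_diag (m : ℕ) (x : Fin (2 ^ m) × Fin (2 ^ m)) :
    hyperbolicKernel m x x = 2 ^ m * (1 + m / 2) := by
  unfold hyperbolicKernel
  rw [Finset.sum_range_succ']
  have : ∀ j ∈ Finset.range m, haarKernel m (j + 1) x.1 x.1 *
      averagingKernel m (m - (j + 1)) x.2 x.2 = 2 ^ m / 2 := by
    intro j hj
    rw [Finset.mem_range] at hj
    simp only [haarKernel, averagingKernel, if_true]
    have : (2 : ℚ) ^ m = 2 ^ j * 2 * 2 ^ (m - (j + 1)) := by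
      rw [← pow_succ, ← pow_add]; congr 1; omega
    rw [this]
    ring
  rw [Finset.sum_congr rfl this]
  simp [haarKernel, averagingKernel]
  ring

theorem isHomogeneousKernel_hyperbolicKernel (m : ℕ) :
    IsHomogeneousKernel (hyperbolicKernel m) (2 ^ m * (1 + m / 2)) where
  symm x y := by
    simp [hyperbolicKernel, averagingKernel_symm m _ x.2 y.2, haarKernel_symm m _ x.1 y.1]
  diag := hyperbolicKernel_diag m
  one_le := by
    have h1 : (1 : ℚ) ≤ 2 ^ m := one_le_pow₀ (by norm_num)
    have h2 : (0 : ℚ) ≤ m := by positivity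
    nlinarith
  section_reproduces y := by
    unfold hyperbolicKernel
    simp only [Rat.cast_sum, Rat.cast_mul]
    refine Reproduces.sum fun j hj => ?_
    rw [Finset.mem_range] at hj
    refine hyperbolicKernel_reproduces (i := j) (by omega) (fun b a a' h => ?_) fun a b b' h => ?_
    · have := haarKernel_constantAtLevel m j y.1 a a' h
      simp only at this
      simp only [this]
    · have := averagingKernel_constantAtLevel m (m - j) y.2 b b' h
      simp only at this
      simp only [this]
  const_reproduces a :=
    hyperbolicKernel_reproduces (i := 0) (Nat.zero_le _) (fun _ _ _ _ => rfl) fun _ _ _ _ => rfl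

end HyperbolicKernel

/-! ### Dyadic cells and their left endpoints. -/

section Cells

/-- The index of the dyadic interval of length `2 ^ (-m)` that contains `x ∈ [0, 1]`. -/
noncomputable def cellIndex (m : ℕ) (x : ℝ) : Fin (2 ^ m) :=
  ⟨min ⌊2 ^ m * x⌋₊ (2 ^ m - 1), by have : 0 < 2 ^ m := by positivity
                                    omega⟩

/-- The index of the dyadic square of side `2 ^ (-m)` that contains `z ∈ [0, 1]²`. -/
noncomputable def cell (m : ℕ) (z : ℝ × ℝ) : Fin (2 ^ m) × Fin (2 ^ m) :=
  (cellIndex m z.1, cellIndex m z.2)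

/-- The left endpoint of the dyadic interval of level `j` that contains the cell `a`. -/
noncomputable def dyadicLeft (m j : ℕ) (a : Fin (2 ^ m)) : ℝ :=
  (((a : ℕ) / 2 ^ (m - j) : ℕ) : ℝ) / 2 ^ j

theorem cellIndex_bounds {m : ℕ} {x : ℝ} (hx : x ∈ Set.Icc (0 : ℝ) 1) :
    ((cellIndex m x : ℕ) : ℝ) ≤ 2 ^ m * x ∧ 2 ^ m * x ≤ (cellIndex m x : ℕ) + 1 := by
  have h0 : (0 : ℝ) ≤ 2 ^ m * x := mul_nonneg (by positivity) hx.1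
  have hp : 0 < 2 ^ m := by positivity
  simp only [cellIndex]
  constructor
  · exact le_trans (by exact_mod_cast min_le_left _ _) (Nat.floor_le h0)
  · rcases le_total ⌊2 ^ m * x⌋₊ (2 ^ m - 1) with h | h
    · rw [min_eq_left h]; exact (Nat.lt_floor_add_one _).le
    · rw [min_eq_right h]
      have : ((2 ^ m - 1 : ℕ) : ℝ) + 1 = 2 ^ m := by
        rw [Nat.cast_sub hp]; push_cast; ring
      rw [this]
      nlinarith [hx.2, show (0 : ℝ) < 2 ^ m by positivity]

/-- The hypothesis lists sign tests of polynomials in the coordinate, so a decision tree can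
determine the cell. It holds for all reals, since the index is clamped at both ends. -/
theorem cellIndex_congr {m : ℕ} {x y : ℝ}
    (h : ∀ j : Fin (2 ^ m), ((j : ℕ) : ℝ) ≤ 2 ^ m * x ↔ ((j : ℕ) : ℝ) ≤ 2 ^ m * y) :
    cellIndex m x = cellIndex m y := by
  have key : ∀ {x y : ℝ},
      (∀ j : Fin (2 ^ m), ((j : ℕ) : ℝ) ≤ 2 ^ m * x ↔ ((j : ℕ) : ℝ) ≤ 2 ^ m * y) →
      (cellIndex m x : ℕ) ≤ cellIndex m y := by
    intro x y h
    rcases Nat.eq_zero_or_pos (cellIndex m x) with h0 | h0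
    · omega
    refine le_min ?_ (Nat.le_sub_one_of_lt (cellIndex m x).2)
    rw [Nat.le_floor_iff' h0.ne', ← h, ← Nat.le_floor_iff' h0.ne']
    exact min_le_left _ _
  exact Fin.ext (le_antisymm (key h) (key fun j => (h j).symm))

theorem dyadicLeft_bounds {m j : ℕ} (hj : j ≤ m) {x : ℝ} (hx : x ∈ Set.Icc (0 : ℝ) 1) :
    0 ≤ dyadicLeft m j (cellIndex m x) ∧ dyadicLeft m j (cellIndex m x) ≤ x ∧
      x - dyadicLeft m j (cellIndex m x) ≤ (2 ^ j)⁻¹ := by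
  obtain ⟨h1, h2⟩ := cellIndex_bounds (m := m) hx
  unfold dyadicLeft
  set a : ℕ := (cellIndex m x : ℕ)
  have hb0 : 0 < 2 ^ (m - j) := by positivity
  have hm : (2 : ℝ) ^ m = 2 ^ (m - j) * 2 ^ j := by rw [← pow_add]; congr 1; omega
  have hbR : (0 : ℝ) < 2 ^ (m - j) := by positivity
  have hjR : (0 : ℝ) < 2 ^ j := by positivity
  have l1 : (((a / 2 ^ (m - j) : ℕ) : ℝ)) * 2 ^ (m - j) ≤ a := by
    exact_mod_cast Nat.div_mul_le_self _ _
  have l2 : (a : ℝ) + 1 ≤ ((a / 2 ^ (m - j) : ℕ) : ℝ) * 2 ^ (m - j) + 2 ^ (m - j) := by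
    exact_mod_cast Nat.lt_div_mul_add hb0 (a := a)
  set q : ℝ := ((a / 2 ^ (m - j) : ℕ) : ℝ)
  have r1 : q ≤ 2 ^ j * x := by
    refine le_of_mul_le_mul_right ?_ hbR
    calc q * 2 ^ (m - j) ≤ 2 ^ m * x := l1.trans h1
      _ = _ := by rw [hm]; ring
  have r2 : 2 ^ j * x ≤ q + 1 := by
    refine le_of_mul_le_mul_right ?_ hbR
    calc 2 ^ j * x * 2 ^ (m - j) = 2 ^ m * x := by rw [hm]; ring
      _ ≤ (q + 1) * 2 ^ (m - j) := by linarith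
  refine ⟨by positivity, ?_, ?_⟩
  · rw [div_le_iff₀ hjR]; linarith
  · rw [sub_le_iff_le_add, inv_eq_one_div, ← add_div, le_div_iff₀ hjR]; linarith

theorem dyadicLeft_mem {m j : ℕ} (hj : j ≤ m) {x : ℝ} (hx : x ∈ Set.Icc (0 : ℝ) 1) :
    dyadicLeft m j (cellIndex m x) ∈ Set.Icc (0 : ℝ) 1 :=
  ⟨(dyadicLeft_bounds hj hx).1, (dyadicLeft_bounds hj hx).2.1.trans hx.2⟩

theorem abs_sub_dyadicLeft_le {m j : ℕ} (hj : j ≤ m) {x : ℝ} (hx : x ∈ Set.Icc (0 : ℝ) 1) :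
    |x - dyadicLeft m j (cellIndex m x)| ≤ (2 ^ j)⁻¹ := by
  rw [abs_of_nonneg (sub_nonneg.2 (dyadicLeft_bounds hj hx).2.1)]
  exact (dyadicLeft_bounds hj hx).2.2

theorem abs_dyadicLeft_succ_sub_le {m j : ℕ} (hj : j + 1 ≤ m) (a : Fin (2 ^ m)) :
    |dyadicLeft m (j + 1) a - dyadicLeft m j a| ≤ (2 ^ (j + 1))⁻¹ := by
  unfold dyadicLeft
  have e : (a : ℕ) / 2 ^ (m - j) = (a : ℕ) / 2 ^ (m - (j + 1)) / 2 := by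
    rw [Nat.div_div_eq_div_mul, ← pow_succ]; congr 2; omega
  rw [e]
  set q := (a : ℕ) / 2 ^ (m - (j + 1))
  have h1 : ((q / 2 : ℕ) : ℝ) * 2 ≤ q := by exact_mod_cast Nat.div_mul_le_self _ _
  have h2 : (q : ℝ) ≤ ((q / 2 : ℕ) : ℝ) * 2 + 1 := by exact_mod_cast (by omega)
  rw [show (q : ℝ) / 2 ^ (j + 1) - ((q / 2 : ℕ) : ℝ) / 2 ^ j =
    (q - ((q / 2 : ℕ) : ℝ) * 2) * (2 ^ (j + 1))⁻¹ by field_simp; ring]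
  rw [abs_of_nonneg (mul_nonneg (by linarith) (by positivity))]
  exact mul_le_of_le_one_left (by positivity) (by linarith)

theorem dyadicLeft_constantAtLevel (m j : ℕ) : ConstantAtLevel m j (dyadicLeft m j) := by
  intro a b h
  simp only [dyadicLeft, h]

end Cells

/-! ### Sparse grid approximation of mixed Hölder functions. -/

section Approximation

/-- The sparse grid (Smolyak) approximation of `f` from its values at dyadic points. -/
noncomputable def hyperbolicApprox (f : ℝ × ℝ → ℝ) (m : ℕ) (g : Fin (2 ^ m) × Fin (2 ^ m)) : ℝ :=
  f (dyadicLeft m 0 g.1, dyadicLeft m m g.2) +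
    ∑ j ∈ Finset.range m,
      (f (dyadicLeft m (j + 1) g.1, dyadicLeft m (m - (j + 1)) g.2) -
        f (dyadicLeft m j g.1, dyadicLeft m (m - (j + 1)) g.2))

theorem reproduces_comp_dyadicLeft (f : ℝ × ℝ → ℝ) {m i j : ℕ} (hij : i + j ≤ m) :
    Reproduces (hyperbolicKernel m) fun g => f (dyadicLeft m i g.1, dyadicLeft m j g.2) := by
  refine hyperbolicKernel_reproduces (i := i) (by omega) (fun b a a' h => ?_) fun a b b' h => ?_
  · simp only [dyadicLeft_constantAtLevel m i a a' h]
  · simp only [(dyadicLeft_constantAtLevel m j).mono (by omega : j ≤ m - i) b b' h]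

theorem hyperbolicApprox_reproduces (f : ℝ × ℝ → ℝ) (m : ℕ) :
    Reproduces (hyperbolicKernel m) (hyperbolicApprox f m) := by
  refine (reproduces_comp_dyadicLeft f (by omega)).add (Reproduces.sum fun j hj => ?_)
  rw [Finset.mem_range] at hj
  exact (reproduces_comp_dyadicLeft f (i := j + 1) (j := m - (j + 1)) (by omega)).sub
    (reproduces_comp_dyadicLeft f (i := j) (j := m - (j + 1)) (by omega))

/-- Telescope `f (·, y)` over dyadic levels in the first variable, and in the increment from level
`j` to `j + 1` replace `y` by its endpoint of level `m - (j + 1)`. The mixed difference so committed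
spans a rectangle of area at most `2 ^ (-m)`, so all `m` increments cost the same; the extra `2`
counts the two ends of the telescope. -/
theorem MixedHolder.abs_sub_hyperbolicApprox_le {c α : ℝ} {f : ℝ × ℝ → ℝ}
    (hf : MixedHolder c α f) (hc : 0 ≤ c) (hα : 0 ≤ α) (m : ℕ) {z : ℝ × ℝ} (hz : z ∈ unitSquare) :
    |f z - hyperbolicApprox f m (cell m z)| ≤ (m + 2) * (c * ((2 ^ m)⁻¹) ^ α) := by
  obtain ⟨x, y⟩ := z
  obtain ⟨hx, hy⟩ := hz
  simp only at hx hy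
  simp only [cell, hyperbolicApprox]
  set a := cellIndex m x
  set b := cellIndex m y
  have tele := Finset.sum_range_sub (fun j => f (dyadicLeft m j a, y)) m
  have key : f (x, y) - (f (dyadicLeft m 0 a, dyadicLeft m m b) +
      ∑ j ∈ Finset.range m, (f (dyadicLeft m (j + 1) a, dyadicLeft m (m - (j + 1)) b) -
        f (dyadicLeft m j a, dyadicLeft m (m - (j + 1)) b))) =
      (f (x, y) - f (dyadicLeft m m a, y)) +
      (f (dyadicLeft m 0 a, y) - f (dyadicLeft m 0 a, dyadicLeft m m b)) +
      ∑ j ∈ Finset.range m, (f (dyadicLeft m (j + 1) a, y) - f (dyadicLeft m j a, y) -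
        f (dyadicLeft m (j + 1) a, dyadicLeft m (m - (j + 1)) b) +
        f (dyadicLeft m j a, dyadicLeft m (m - (j + 1)) b)) := by
    have e : ∑ j ∈ Finset.range m, (f (dyadicLeft m (j + 1) a, y) - f (dyadicLeft m j a, y) -
        f (dyadicLeft m (j + 1) a, dyadicLeft m (m - (j + 1)) b) +
        f (dyadicLeft m j a, dyadicLeft m (m - (j + 1)) b)) =
        ∑ j ∈ Finset.range m, (f (dyadicLeft m (j + 1) a, y) - f (dyadicLeft m j a, y)) -
        ∑ j ∈ Finset.range m, (f (dyadicLeft m (j + 1) a, dyadicLeft m (m - (j + 1)) b) -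
          f (dyadicLeft m j a, dyadicLeft m (m - (j + 1)) b)) := by
      rw [← Finset.sum_sub_distrib]
      exact Finset.sum_congr rfl fun _ _ => by ring
    rw [e, tele]
    ring
  rw [key]
  set η := c * ((2 ^ m)⁻¹ : ℝ) ^ α
  have b1 : |f (x, y) - f (dyadicLeft m m a, y)| ≤ η :=
    (hf.fst _ (dyadicLeft_mem le_rfl hx) _ hx _ hy).trans <|
      mul_le_mul_of_nonneg_left (Real.rpow_le_rpow (abs_nonneg _)
        (abs_sub_dyadicLeft_le le_rfl hx) hα) hc
  have b2 : |f (dyadicLeft m 0 a, y) - f (dyadicLeft m 0 a, dyadicLeft m m b)| ≤ η :=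
    (hf.snd _ (dyadicLeft_mem (Nat.zero_le _) hx) _ (dyadicLeft_mem le_rfl hy) _ hy).trans <|
      mul_le_mul_of_nonneg_left (Real.rpow_le_rpow (abs_nonneg _)
        (abs_sub_dyadicLeft_le le_rfl hy) hα) hc
  have b3 : |∑ j ∈ Finset.range m, (f (dyadicLeft m (j + 1) a, y) - f (dyadicLeft m j a, y) -
        f (dyadicLeft m (j + 1) a, dyadicLeft m (m - (j + 1)) b) +
        f (dyadicLeft m j a, dyadicLeft m (m - (j + 1)) b))| ≤ m * η := by
    refine (Finset.abs_sum_le_sum_abs _ _).trans ?_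
    calc _ ≤ ∑ _j ∈ Finset.range m, η := Finset.sum_le_sum fun j hj => ?_
      _ = m * η := by simp
    rw [Finset.mem_range] at hj
    have h := hf.mixed _ (dyadicLeft_mem (m := m) (j := j) (by omega) hx) _
      (dyadicLeft_mem (j := j + 1) hj hx) _
      (dyadicLeft_mem (m := m) (j := m - (j + 1)) (by omega) hy) _ hy
    refine h.trans (mul_le_mul_of_nonneg_left (Real.rpow_le_rpow (by positivity) ?_ hα) hc)
    calc _ ≤ ((2 : ℝ) ^ (j + 1))⁻¹ * (2 ^ (m - (j + 1)))⁻¹ :=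
          mul_le_mul (abs_dyadicLeft_succ_sub_le hj a) (abs_sub_dyadicLeft_le (by omega) hy)
            (abs_nonneg _) (by positivity)
      _ = (2 ^ m)⁻¹ := by rw [← mul_inv, ← pow_add]; congr 2; omega
  calc _ ≤ η + η + m * η := (abs_add_le _ _).trans (add_le_add ((abs_add_le _ _).trans
        (add_le_add b1 b2)) b3)
    _ = _ := by ring

theorem MixedHolder.abs_sub_le {c α : ℝ} {f : ℝ × ℝ → ℝ} (hf : MixedHolder c α f) (hc : 0 ≤ c)
    (hα : 0 ≤ α) {z w : ℝ × ℝ} (hz : z ∈ unitSquare) (hw : w ∈ unitSquare) :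
    |f z - f w| ≤ 2 * c := by
  have hone : ∀ {s t : ℝ}, s ∈ Set.Icc (0 : ℝ) 1 → t ∈ Set.Icc (0 : ℝ) 1 → |s - t| ^ α ≤ 1 :=
    fun hs ht => Real.rpow_le_one (abs_nonneg _)
      (abs_sub_le_iff.2 ⟨by linarith [hs.2, ht.1], by linarith [hs.1, ht.2]⟩) hα
  have h1 := hf.fst w.1 hw.1 z.1 hz.1 z.2 hz.2
  have h2 := hf.snd w.1 hw.1 w.2 hw.2 z.2 hz.2
  have h3 := mul_le_mul_of_nonneg_left (hone hz.1 hw.1) hc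
  have h4 := mul_le_mul_of_nonneg_left (hone hz.2 hw.2) hc
  calc |f z - f w| = |(f (z.1, z.2) - f (w.1, z.2)) + (f (w.1, z.2) - f (w.1, w.2))| := by
        congr 1; ring
    _ ≤ _ := abs_add_le _ _
    _ ≤ 2 * c := by linarith

theorem MixedHolder.continuousOn {c α : ℝ} {f : ℝ × ℝ → ℝ} (hf : MixedHolder c α f)
    (hα : 0 < α) : ContinuousOn f unitSquare := by
  intro w hw
  have h0 : Filter.Tendsto (fun z : ℝ × ℝ => c * |z.1 - w.1| ^ α + c * |z.2 - w.2| ^ α)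
      (nhdsWithin w unitSquare) (nhds 0) := by
    have : Continuous (fun z : ℝ × ℝ => c * |z.1 - w.1| ^ α + c * |z.2 - w.2| ^ α) := by
      have := hα.le
      fun_prop (disch := assumption)
    have := (this.tendsto w).mono_left (nhdsWithin_le_nhds (s := unitSquare))
    simpa [Real.zero_rpow hα.ne'] using this
  refine tendsto_iff_dist_tendsto_zero.2 (squeeze_zero' (Filter.Eventually.of_forall
    fun _ => dist_nonneg) ?_ h0)
  filter_upwards [self_mem_nhdsWithin] with z hz
  have h1 := hf.fst w.1 hw.1 z.1 hz.1 z.2 hz.2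
  have h2 := hf.snd w.1 hw.1 w.2 hw.2 z.2 hz.2
  rw [Real.dist_eq]
  calc |f z - f w| = |(f (z.1, z.2) - f (w.1, z.2)) + (f (w.1, z.2) - f (w.1, w.2))| := by
        congr 1; ring
    _ ≤ _ := (abs_add_le _ _).trans (add_le_add h1 h2)

theorem isCompact_unitSquare : IsCompact unitSquare := isCompact_Icc.prod isCompact_Icc

theorem measurableSet_unitSquare : MeasurableSet unitSquare :=
  measurableSet_Icc.prod measurableSet_Icc

theorem volume_unitSquare : volume unitSquare = 1 := by
  rw [unitSquare, Measure.volume_eq_prod, Measure.prod_prod]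
  simp

theorem MixedHolder.integrableOn {c α : ℝ} {f : ℝ × ℝ → ℝ} (hf : MixedHolder c α f)
    (hα : 0 < α) : IntegrableOn f unitSquare :=
  (hf.continuousOn hα).integrableOn_compact isCompact_unitSquare

theorem eq_of_holder_exponent_gt_one {c α : ℝ} (hα : 1 < α) {g : ℝ → ℝ}
    (hg : ∀ x ∈ Set.Icc (0 : ℝ) 1, ∀ y ∈ Set.Icc (0 : ℝ) 1, |g y - g x| ≤ c * |y - x| ^ α)
    {x : ℝ} (hx : x ∈ Set.Icc (0 : ℝ) 1) : g x = g 0 := by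
  have hd : ∀ z ∈ Set.Icc (0 : ℝ) 1, HasDerivWithinAt g 0 (Set.Icc 0 1) z := by
    intro z hz
    rw [hasDerivWithinAt_iff_tendsto]
    have h0 : Filter.Tendsto (fun y : ℝ => c * |y - z| ^ (α - 1))
        (nhdsWithin z (Set.Icc 0 1)) (nhds 0) := by
      have hα' : 0 ≤ α - 1 := by linarith
      have : Continuous (fun y : ℝ => c * |y - z| ^ (α - 1)) := by
        fun_prop (disch := assumption)
      have := (this.tendsto z).mono_left (nhdsWithin_le_nhds (s := Set.Icc 0 1))
      simpa [Real.zero_rpow (by linarith : α - 1 ≠ 0)] using this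
    refine squeeze_zero' (Filter.Eventually.of_forall fun _ => by positivity) ?_ h0
    filter_upwards [self_mem_nhdsWithin] with y hy
    have h := hg z hz y hy
    simp only [smul_zero, sub_zero, Real.norm_eq_abs]
    rcases eq_or_ne y z with rfl | hne
    · simp [Real.zero_rpow (by linarith : α - 1 ≠ 0)]
    have hp : 0 < |y - z| := abs_pos.2 (sub_ne_zero.2 hne)
    rw [inv_mul_le_iff₀ hp]
    calc _ ≤ _ := h
      _ = |y - z| * (c * |y - z| ^ (α - 1)) := by
        rw [Real.rpow_sub_one hp.ne']; field_simp
  refine constant_of_has_deriv_right_zero (fun z hz => (hd z hz).continuousWithinAt)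
    (fun z hz => ?_) x hx
  exact (hd z ⟨hz.1, hz.2.le⟩).mono_of_mem_nhdsWithin (Icc_mem_nhdsGE_of_mem hz)

/-- Such an `f` has zero derivative in each variable, hence is constant on the square and satisfies
every mixed Hölder condition. This reduces exponents above one to exponent one. -/
theorem MixedHolder.of_exponent_gt_one {c α : ℝ} {f : ℝ × ℝ → ℝ} (hf : MixedHolder c α f)
    (hα : 1 < α) {c' β : ℝ} (hc' : 0 ≤ c') : MixedHolder c' β f := by
  have hconst : ∀ x ∈ Set.Icc (0 : ℝ) 1, ∀ y ∈ Set.Icc (0 : ℝ) 1, f (x, y) = f (0, 0) := by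
    intro x hx y hy
    rw [eq_of_holder_exponent_gt_one hα (g := fun t => f (t, y))
      (fun s hs t ht => hf.fst s hs t ht y hy) hx]
    exact eq_of_holder_exponent_gt_one hα (g := fun t => f (0, t))
      (fun s hs t ht => hf.snd 0 (by simp) s hs t ht) hy
  constructor
  · intro x hx x' hx' y hy
    rw [hconst x hx y hy, hconst x' hx' y hy, sub_self, abs_zero]
    positivity
  · intro x hx y hy y' hy'
    rw [hconst x hx y hy, hconst x hx y' hy', sub_self, abs_zero]
    positivity
  · intro x hx x' hx' y hy y' hy'
    rw [hconst x hx y hy, hconst x hx y' hy', hconst x' hx' y hy, hconst x' hx' y' hy']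
    simp only [sub_self, zero_sub, neg_add_cancel, abs_zero]
    positivity

end Approximation

/-! ### The uniform measure on cells, and integrals as means over cells. -/

section Integration

theorem measurable_cell (m : ℕ) : Measurable (cell m) := by
  have h : Measurable (cellIndex m) := by
    have h1 : Measurable fun x : ℝ => ⌊2 ^ m * x⌋₊ := Nat.measurable_floor.comp (by fun_prop)
    refine measurable_to_countable' fun a => ?_
    have : cellIndex m ⁻¹' {a} = (fun x : ℝ => ⌊2 ^ m * x⌋₊) ⁻¹' {q | min q (2 ^ m - 1) = a} := by
      ext x; simp [cellIndex, Fin.ext_iff]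
    rw [this]
    exact h1 (MeasurableSet.of_discrete)
  exact (h.comp measurable_fst).prodMk (h.comp measurable_snd)

theorem volume_cell_le (m : ℕ) (g : Fin (2 ^ m) × Fin (2 ^ m)) :
    volume (unitSquare ∩ cell m ⁻¹' {g}) ≤
      ENNReal.ofReal ((Fintype.card (Fin (2 ^ m) × Fin (2 ^ m)) : ℝ)⁻¹) := by
  have hsub : unitSquare ∩ cell m ⁻¹' {g} ⊆
      Set.Icc (((g.1 : ℕ) : ℝ) / 2 ^ m) ((((g.1 : ℕ) : ℝ) + 1) / 2 ^ m) ×ˢ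
      Set.Icc (((g.2 : ℕ) : ℝ) / 2 ^ m) ((((g.2 : ℕ) : ℝ) + 1) / 2 ^ m) := by
    rintro z ⟨hz, rfl⟩
    have hp : (0 : ℝ) < 2 ^ m := by positivity
    have h1 := cellIndex_bounds (m := m) hz.1
    have h2 := cellIndex_bounds (m := m) hz.2
    simp only [Set.mem_prod, Set.mem_Icc, cell, div_le_iff₀ hp, le_div_iff₀ hp]
    exact ⟨⟨by linarith, by linarith⟩, ⟨by linarith, by linarith⟩⟩
  refine (measure_mono hsub).trans ?_
  rw [Measure.volume_eq_prod, Measure.prod_prod, Real.volume_Icc, Real.volume_Icc,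
    ← ENNReal.ofReal_mul (by rw [← sub_div]; simp)]
  apply ENNReal.ofReal_le_ofReal
  simp only [← sub_div, add_sub_cancel_left, Fintype.card_prod, Fintype.card_fin]
  push_cast
  rw [mul_inv, one_div]

theorem volume_real_cell (m : ℕ) (g : Fin (2 ^ m) × Fin (2 ^ m)) :
    ((volume.restrict unitSquare).map (cell m)).real {g} =
      (Fintype.card (Fin (2 ^ m) × Fin (2 ^ m)) : ℝ)⁻¹ := by
  set ν := (volume.restrict unitSquare).map (cell m) with hν
  have hprob : IsProbabilityMeasure (volume.restrict unitSquare) :=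
    ⟨by rw [Measure.restrict_apply_univ, volume_unitSquare]⟩
  have : IsProbabilityMeasure ν :=
    Measure.isProbabilityMeasure_map (measurable_cell m).aemeasurable
  have hle : ∀ g ∈ Finset.univ, ν.real {g} ≤
      (Fintype.card (Fin (2 ^ m) × Fin (2 ^ m)) : ℝ)⁻¹ := by
    intro g _
    rw [Measure.real]
    refine ENNReal.toReal_le_of_le_ofReal (by positivity) ?_
    rw [hν, Measure.map_apply (measurable_cell m) (measurableSet_singleton g),
      Measure.restrict_apply (measurable_cell m (measurableSet_singleton g)), Set.inter_comm]
    exact volume_cell_le m g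
  -- Upper bounds suffice: the masses sum to one, and so do the bounds, hence equality holds for
  -- every cell.
  refine (Finset.sum_eq_sum_iff_of_le hle).1 ?_ g (Finset.mem_univ g)
  rw [sum_measureReal_singleton, Finset.coe_univ, probReal_univ, Finset.sum_const,
    Finset.card_univ, nsmul_eq_mul, mul_inv_cancel₀ (by exact_mod_cast Fintype.card_ne_zero)]

theorem setIntegral_comp_cell (m : ℕ) (h : Fin (2 ^ m) × Fin (2 ^ m) → ℝ) :
    ∫ z in unitSquare, h (cell m z) =
      (∑ g, h g) / Fintype.card (Fin (2 ^ m) × Fin (2 ^ m)) := by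
  have hprob : IsProbabilityMeasure (volume.restrict unitSquare) :=
    ⟨by rw [Measure.restrict_apply_univ, volume_unitSquare]⟩
  have : IsProbabilityMeasure ((volume.restrict unitSquare).map (cell m)) :=
    Measure.isProbabilityMeasure_map (measurable_cell m).aemeasurable
  rw [← integral_map (measurable_cell m).aemeasurable
    (measurable_of_finite h).aestronglyMeasurable, integral_fintype Integrable.of_finite]
  simp only [volume_real_cell, smul_eq_mul]
  rw [← Finset.mul_sum, mul_comm, div_eq_mul_inv]

theorem abs_setIntegral_sub_mean_le {f : ℝ × ℝ → ℝ} (hf : IntegrableOn f unitSquare) {m : ℕ}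
    {h : Fin (2 ^ m) × Fin (2 ^ m) → ℝ} {η : ℝ}
    (hη : ∀ z ∈ unitSquare, |f z - h (cell m z)| ≤ η) :
    |(∫ z in unitSquare, f z) - (∑ g, h g) / Fintype.card (Fin (2 ^ m) × Fin (2 ^ m))| ≤ η := by
  have hprob : IsProbabilityMeasure (volume.restrict unitSquare) :=
    ⟨by rw [Measure.restrict_apply_univ, volume_unitSquare]⟩
  have hint : Integrable (fun z => h (cell m z)) (volume.restrict unitSquare) :=
    (Integrable.of_finite (f := h)).comp_measurable (measurable_cell m)
  rw [← setIntegral_comp_cell, ← integral_sub hf hint]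
  have := norm_setIntegral_le_of_norm_le_const (μ := volume) (s := unitSquare)
    (f := fun z => f z - h (cell m z)) (C := η) (by rw [volume_unitSquare]; simp) hη
  simpa [Measure.real, volume_unitSquare] using this

end Integration

/-! ### The estimator, its decision tree and its deterministic error bound. -/

section Estimator

/-- The mean of the function reconstructed by the Kaczmarz iteration from the values `v` at the
points `x`; the value at the first point serves as the initial guess. -/
noncomputable def kaczmarzMean (m k : ℕ) (x : Fin (k + 1) → ℝ × ℝ) (v : Fin (k + 1) → ℝ) : ℝ :=
  (∑ g, kaczmarz (hyperbolicKernel m) k (fun _ => v 0) (fun i => cell m (x i.succ))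
    (fun i => v i.succ) g) / Fintype.card (Fin (2 ^ m) × Fin (2 ^ m))

/-- Test the polynomials one after another; on each leaf all signs are fixed, so `out` is a single
polynomial there. -/
theorem exists_decisionTree_of_signs {ι κ : Type} [Finite κ] (p : κ → MvPolynomial ι ℚ)
    (out : (ι → ℝ) → MvPolynomial ι ℚ)
    (hout : ∀ a b : ι → ℝ, (∀ i, (0 : ℝ) ≤ MvPolynomial.aeval a (p i) ↔
      (0 : ℝ) ≤ MvPolynomial.aeval b (p i)) → out a = out b) :
    ∃ T : DecisionTree ι, ∀ a, T.eval a = MvPolynomial.aeval a (out a) := by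
  classical
  have := Fintype.ofFinite κ
  suffices H : ∀ (s : Finset κ) (A : Set (ι → ℝ)),
      (∀ a ∈ A, ∀ b ∈ A, (∀ i ∈ s, (0 : ℝ) ≤ MvPolynomial.aeval a (p i) ↔
        (0 : ℝ) ≤ MvPolynomial.aeval b (p i)) → out a = out b) →
      ∃ T : DecisionTree ι, ∀ a ∈ A, T.eval a = MvPolynomial.aeval a (out a) by
    obtain ⟨T, hT⟩ := H Finset.univ Set.univ fun a _ b _ h => hout a b fun i =>
      h i (Finset.mem_univ i)
    exact ⟨T, fun a => hT a (Set.mem_univ a)⟩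
  intro s
  induction s using Finset.induction_on with
  | empty =>
    intro A hA
    rcases A.eq_empty_or_nonempty with rfl | ⟨a, ha⟩
    · exact ⟨.output 0, by simp⟩
    · refine ⟨.output (out a), fun b hb => ?_⟩
      rw [hA b hb a ha (by simp)]
      rfl
  | insert i s _ ih =>
    intro A hA
    obtain ⟨T₁, h₁⟩ := ih {a ∈ A | (0 : ℝ) ≤ MvPolynomial.aeval a (p i)} fun a ha b hb h =>
      hA a ha.1 b hb.1 fun j hj => by
        rcases Finset.mem_insert.1 hj with rfl | hj
        · exact iff_of_true ha.2 hb.2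
        · exact h j hj
    obtain ⟨T₂, h₂⟩ := ih {a ∈ A | ¬ (0 : ℝ) ≤ MvPolynomial.aeval a (p i)} fun a ha b hb h =>
      hA a ha.1 b hb.1 fun j hj => by
        rcases Finset.mem_insert.1 hj with rfl | hj
        · exact iff_of_false ha.2 hb.2
        · exact h j hj
    refine ⟨.test (p i) T₁ T₂, fun a ha => ?_⟩
    rw [DecisionTree.eval]
    split_ifs with h
    · exact h₁ a ⟨ha, h⟩
    · exact h₂ a ⟨ha, h⟩

theorem exists_decisionTree_kaczmarzMean (m : ℕ) {k l : ℕ} (e : Fin (k + 1) → Fin l) :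
    ∃ T : DecisionTree (Fin l × Fin 3), ∀ a : Fin l × Fin 3 → ℝ,
      T.eval a = kaczmarzMean m k (fun i => (a (e i, 0), a (e i, 1))) (fun i => a (e i, 2)) := by
  let p : Fin (k + 1) × Bool × Fin (2 ^ m) → MvPolynomial (Fin l × Fin 3) ℚ := fun t =>
    MvPolynomial.C (2 ^ m) * MvPolynomial.X (e t.1, if t.2.1 then 0 else 1) -
      MvPolynomial.C ((t.2.2 : ℕ) : ℚ)
  let out : (Fin l × Fin 3 → ℝ) → MvPolynomial (Fin l × Fin 3) ℚ := fun a =>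
    ((Fintype.card (Fin (2 ^ m) × Fin (2 ^ m)) : ℚ)⁻¹) •
      ∑ g, kaczmarz (hyperbolicKernel m) k (fun _ => MvPolynomial.X (e 0, 2))
        (fun i => cell m (a (e i.succ, 0), a (e i.succ, 1)))
        (fun i => MvPolynomial.X (e i.succ, 2)) g
  have hp : ∀ a t, (0 : ℝ) ≤ MvPolynomial.aeval a (p t) ↔
      ((t.2.2 : ℕ) : ℝ) ≤ 2 ^ m * a (e t.1, if t.2.1 then 0 else 1) := by
    intro a t
    simp [p]
  obtain ⟨T, hT⟩ := exists_decisionTree_of_signs p out fun a b h => by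
    simp only [hp] at h
    have hc : (fun i : Fin k => cell m (a (e i.succ, 0), a (e i.succ, 1))) =
        fun i => cell m (b (e i.succ, 0), b (e i.succ, 1)) := by
      funext i
      have h0 : cellIndex m (a (e i.succ, 0)) = cellIndex m (b (e i.succ, 0)) :=
        cellIndex_congr fun j => h (i.succ, true, j)
      have h1 : cellIndex m (a (e i.succ, 1)) = cellIndex m (b (e i.succ, 1)) :=
        cellIndex_congr fun j => h (i.succ, false, j)
      simp only [cell, h0, h1]
    simp only [out, hc]
  refine ⟨T, fun a => ?_⟩
  rw [hT]
  simp only [out, map_smul, map_sum, kaczmarz_map, MvPolynomial.aeval_X, kaczmarzMean,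
    Rat.smul_def]
  push_cast
  rw [mul_comm, div_eq_mul_inv]

/-- The part of the error of the Kaczmarz iteration that stems from the initial guess, as a
function of the cells `ξ` of the sample points. -/
noncomputable def initialError {G : Type*} (K : G → G → ℚ) (h : G → ℝ) (k : ℕ)
    (ξ : Fin (k + 1) → G) : G → ℝ :=
  kaczmarz K k (fun g => h (ξ 0) - h g) (fun i => ξ i.succ) fun _ => 0

/-- The three terms are the approximation error of `h`, the decay of the initial guess and the noise
`f - h` in the data. -/
theorem abs_setIntegral_sub_kaczmarzMean_le {f : ℝ × ℝ → ℝ} (hf : IntegrableOn f unitSquare)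
    {m k : ℕ} {h : Fin (2 ^ m) × Fin (2 ^ m) → ℝ} {η : ℝ}
    (hη : ∀ z ∈ unitSquare, |f z - h (cell m z)| ≤ η)
    {x : Fin (k + 1) → ℝ × ℝ} (hx : ∀ i, x i ∈ unitSquare) :
    |(∫ z in unitSquare, f z) - kaczmarzMean m k x (fun i => f (x i))| ≤
      η + √(meanSq (initialError (hyperbolicKernel m) h k fun i => cell m (x i))) +
        η * √(1 + k / (2 ^ m * (1 + m / 2))) := by
  have hK := isHomogeneousKernel_hyperbolicKernel m
  set K := hyperbolicKernel m
  set u := initialError K h k fun i => cell m (x i)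
  set v := kaczmarz K k (fun _ => f (x 0) - h (cell m (x 0))) (fun i => cell m (x i.succ))
    fun i => f (x i.succ) - h (cell m (x i.succ))
  have hη0 : 0 ≤ η := (abs_nonneg _).trans (hη _ (hx 0))
  -- The iteration is linear in start and data jointly: `h` with its own exact data is a fixed
  -- point, `u` has zero data, and `v` starts from a constant of size at most `η` with data of size
  -- at most `η`.
  have split : kaczmarz K k (fun _ => f (x 0)) (fun i => cell m (x i.succ))
      (fun i => f (x i.succ)) = h + u + v := by
    rw [← kaczmarz_exact_data K k h fun i => cell m (x i.succ)]
    simp only [u, v, initialError]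
    rw [← kaczmarz_add, ← kaczmarz_add]
    congr 1
    · funext g; simp
    · funext i; simp
  have hv : meanSq v ≤ η ^ 2 * (1 + k / (2 ^ m * (1 + m / 2))) := by
    have h1 := meanSq_kaczmarz_le hK k (hK.const_reproduces (f (x 0) - h (cell m (x 0))))
      (fun i => cell m (x i.succ)) (fun i => f (x i.succ) - h (cell m (x i.succ)))
      fun i => hη _ (hx _)
    have h2 : meanSq (fun _ : Fin (2 ^ m) × Fin (2 ^ m) => f (x 0) - h (cell m (x 0))) ≤ η ^ 2 :=
      meanSq_le_of_abs_le fun _ => hη _ (hx 0)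
    push_cast at h1
    calc meanSq v ≤ _ := h1
      _ ≤ η ^ 2 + k * η ^ 2 / (2 ^ m * (1 + m / 2)) := by gcongr
      _ = _ := by ring
  have hv' : √(meanSq v) ≤ η * √(1 + k / (2 ^ m * (1 + m / 2))) := by
    refine (Real.sqrt_le_sqrt hv).trans ?_
    rw [Real.sqrt_mul (sq_nonneg _), Real.sqrt_sq hη0]
  have e : kaczmarzMean m k x (fun i => f (x i)) =
      (∑ g, h g) / Fintype.card (Fin (2 ^ m) × Fin (2 ^ m)) +
      (∑ g, u g) / Fintype.card (Fin (2 ^ m) × Fin (2 ^ m)) +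
      (∑ g, v g) / Fintype.card (Fin (2 ^ m) × Fin (2 ^ m)) := by
    unfold kaczmarzMean
    rw [split]
    simp only [Pi.add_apply, Finset.sum_add_distrib, add_div]
  have b0 := abs_setIntegral_sub_mean_le hf hη
  have b1 := abs_mean_le_sqrt_meanSq u
  have b2 := (abs_mean_le_sqrt_meanSq v).trans hv'
  rw [e]
  rw [abs_le] at b0 b1 b2 ⊢
  constructor <;> linarith

theorem sum_meanSq_initialError_le {G : Type*} [Fintype G] [Nonempty G] {K : G → G → ℚ} {D : ℚ}
    (hK : IsHomogeneousKernel K D) {h : G → ℝ} (hh : Reproduces K h) {b : ℝ}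
    (hb : ∀ x y, |h x - h y| ≤ b) (k : ℕ) :
    ∑ ξ : Fin (k + 1) → G, meanSq (initialError K h k ξ) ≤
      (Fintype.card G : ℝ) ^ (k + 1) * ((1 - 1 / (D : ℝ)) ^ k * b ^ 2) := by
  have hD : (1 : ℝ) ≤ D := by exact_mod_cast hK.one_le
  have hD' : 0 ≤ 1 - 1 / (D : ℝ) := sub_nonneg.2 ((div_le_one (by linarith)).2 hD)
  rw [← (Fin.consEquiv fun _ => G).sum_comp, Fintype.sum_prod_type]
  calc _ = ∑ x : G, (Fintype.card G * (1 - 1 / (D : ℝ))) ^ k * meanSq fun g => h x - h g :=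
        Finset.sum_congr rfl fun x _ =>
          sum_meanSq_kaczmarz hK k ((hK.const_reproduces (h x)).sub hh)
    _ ≤ ∑ _x : G, (Fintype.card G * (1 - 1 / (D : ℝ))) ^ k * b ^ 2 :=
        Finset.sum_le_sum fun x _ => by
          have := meanSq_le_of_abs_le fun g => hb x g
          gcongr
    _ = _ := by
        simp only [Finset.sum_const, Finset.card_univ, nsmul_eq_mul, mul_pow]
        ring

end Estimator

/-! ### From counting cell sequences to probabilities. -/

section Probability

variable {Ω : Type*} [MeasurableSpace Ω] {P : Measure Ω} [IsProbabilityMeasure P]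

theorem measureReal_cells_mem_le (m : ℕ) {N : ℕ} {X : Fin N → Ω → ℝ × ℝ}
    (hX : ∀ i, pdf.IsUniform (X i) unitSquare P volume) (hind : iIndepFun X P)
    (B : Finset (Fin N → Fin (2 ^ m) × Fin (2 ^ m))) :
    P.real {ω | (fun i => cell m (X i ω)) ∈ B} ≤
      B.card * ((Fintype.card (Fin (2 ^ m) × Fin (2 ^ m)) : ℝ)⁻¹) ^ N := by
  have hpt : ∀ g : Fin N → Fin (2 ^ m) × Fin (2 ^ m),
      P.real {ω | (fun i => cell m (X i ω)) = g} ≤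
        ((Fintype.card (Fin (2 ^ m) × Fin (2 ^ m)) : ℝ)⁻¹) ^ N := by
    intro g
    have hind' := hind.comp (fun _ => cell m) fun _ => measurable_cell m
    have h := hind'.measure_inter_preimage_eq_mul Finset.univ (sets := fun i => {g i})
      fun i _ => measurableSet_singleton _
    have e : {ω | (fun i => cell m (X i ω)) = g} =
        ⋂ i ∈ Finset.univ, (cell m ∘ X i) ⁻¹' {g i} := by
      ext ω; simp [funext_iff]
    rw [Measure.real, e, h]
    refine ENNReal.toReal_le_of_le_ofReal (by positivity) ?_
    rw [ENNReal.ofReal_pow (by positivity)]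
    calc _ ≤ ∏ _i : Fin N,
          ENNReal.ofReal ((Fintype.card (Fin (2 ^ m) × Fin (2 ^ m)) : ℝ)⁻¹) := by
          refine Finset.prod_le_prod' fun i _ => ?_
          rw [Set.preimage_comp, (hX i).measure_preimage (by simp [volume_unitSquare])
            (by simp [volume_unitSquare]) (measurable_cell m (measurableSet_singleton _)),
            volume_unitSquare, div_one]
          exact volume_cell_le m _
      _ = _ := by simp
  have hsub : {ω | (fun i => cell m (X i ω)) ∈ B} ⊆
      ⋃ g ∈ B, {ω | (fun i => cell m (X i ω)) = g} := by
    intro ω hω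
    simpa using hω
  calc _ ≤ P.real (⋃ g ∈ B, {ω | (fun i => cell m (X i ω)) = g}) :=
        measureReal_mono hsub (measure_ne_top _ _)
    _ ≤ ∑ g ∈ B, P.real {ω | (fun i => cell m (X i ω)) = g} := measureReal_biUnion_finset_le _ _
    _ ≤ ∑ _g ∈ B, ((Fintype.card (Fin (2 ^ m) × Fin (2 ^ m)) : ℝ)⁻¹) ^ N :=
        Finset.sum_le_sum fun g _ => hpt g
    _ = _ := by simp

/-- Markov's inequality by counting: bad cell sequences are few by `sum_meanSq_initialError_le`, and
each has probability at most the reciprocal of the number of sequences. Samples outside the square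
form a null event. -/
theorem one_sub_le_measureReal_initialError_le (m : ℕ) {k : ℕ}
    {X : Fin (k + 1) → Ω → ℝ × ℝ} (hX : ∀ i, pdf.IsUniform (X i) unitSquare P volume)
    (hind : iIndepFun X P) {h : Fin (2 ^ m) × Fin (2 ^ m) → ℝ}
    (hh : Reproduces (hyperbolicKernel m) h) {b : ℝ} (hb : ∀ x y, |h x - h y| ≤ b) {τ : ℝ}
    (hτ : 0 < τ) :
    1 - (1 - 1 / ((2 : ℝ) ^ m * (1 + m / 2))) ^ k * b ^ 2 / τ ≤
      P.real {ω | (∀ i, X i ω ∈ unitSquare) ∧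
        meanSq (initialError (hyperbolicKernel m) h k fun i => cell m (X i ω)) ≤ τ} := by
  classical
  have hsum := sum_meanSq_initialError_le (isHomogeneousKernel_hyperbolicKernel m) hh hb k
  push_cast at hsum
  set K := hyperbolicKernel m
  set B : Finset (Fin (k + 1) → Fin (2 ^ m) × Fin (2 ^ m)) :=
    Finset.univ.filter fun ξ => τ < meanSq (initialError K h k ξ)
  have hcard : B.card * τ ≤ ∑ ξ, meanSq (initialError K h k ξ) := by
    calc B.card * τ = ∑ _ξ ∈ B, τ := by simp
      _ ≤ ∑ ξ ∈ B, meanSq (initialError K h k ξ) :=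
          Finset.sum_le_sum fun ξ hξ => (Finset.mem_filter.1 hξ).2.le
      _ ≤ _ := Finset.sum_le_sum_of_subset_of_nonneg (Finset.subset_univ _)
          fun _ _ _ => meanSq_nonneg _
  set M : ℝ := (Fintype.card (Fin (2 ^ m) × Fin (2 ^ m)) : ℝ)
  have hM : 0 < M := by simp only [M]; exact_mod_cast Fintype.card_pos
  have hBle : P.real {ω | (fun i => cell m (X i ω)) ∈ B} ≤
      (1 - 1 / ((2 : ℝ) ^ m * (1 + m / 2))) ^ k * b ^ 2 / τ := by
    refine (measureReal_cells_mem_le m hX hind B).trans ?_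
    rw [le_div_iff₀ hτ, inv_pow, mul_right_comm, ← div_eq_mul_inv, div_le_iff₀ (by positivity),
      mul_comm _ (M ^ (k + 1))]
    exact hcard.trans hsum
  have hout : P.real {ω | ∃ i, X i ω ∉ unitSquare} = 0 := by
    rw [measureReal_eq_zero_iff, Set.ofPred_exists, measure_iUnion_null_iff]
    intro i
    have := (hX i).measure_preimage (by simp [volume_unitSquare]) (by simp [volume_unitSquare])
      measurableSet_unitSquare.compl
    rw [Set.inter_compl_self, measure_empty, ENNReal.zero_div] at this
    exact this
  have hcover : (Set.univ : Set Ω) ⊆ ({ω | (∀ i, X i ω ∈ unitSquare) ∧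
      meanSq (initialError K h k fun i => cell m (X i ω)) ≤ τ} ∪
      {ω | (fun i => cell m (X i ω)) ∈ B}) ∪ {ω | ∃ i, X i ω ∉ unitSquare} := by
    intro ω _
    by_cases h1 : ∀ i, X i ω ∈ unitSquare
    · left
      rcases le_or_gt (meanSq (initialError K h k fun i => cell m (X i ω))) τ with h2 | h2
      · exact Or.inl ⟨h1, h2⟩
      · exact Or.inr (Finset.mem_filter.2 ⟨Finset.mem_univ _, h2⟩)
    · right
      simpa using h1
  have h1 := (measureReal_mono hcover (μ := P)).trans (measureReal_union_le _ _)
  have h2 := measureReal_union_le (μ := P) {ω | (∀ i, X i ω ∈ unitSquare) ∧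
      meanSq (initialError K h k fun i => cell m (X i ω)) ≤ τ}
      {ω | (fun i => cell m (X i ω)) ∈ B}
  rw [probReal_univ] at h1
  linarith

end Probability

/-! ### Choice of parameters and numerical estimates. -/

section Main

theorem exists_cell_eq (m : ℕ) (g : Fin (2 ^ m) × Fin (2 ^ m)) : ∃ z ∈ unitSquare, cell m z = g := by
  have hp : (0 : ℝ) < 2 ^ m := by positivity
  have key : ∀ a : Fin (2 ^ m), (a : ℝ) / 2 ^ m ∈ Set.Icc (0 : ℝ) 1 ∧
      cellIndex m ((a : ℝ) / 2 ^ m) = a := by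
    intro a
    have ha : ((a : ℕ) : ℝ) ≤ 2 ^ m := by exact_mod_cast a.2.le
    refine ⟨⟨by positivity, (div_le_one hp).2 ha⟩, Fin.ext ?_⟩
    simp only [cellIndex]
    rw [mul_div_cancel₀ _ hp.ne', Nat.floor_natCast]
    exact min_eq_left (Nat.le_sub_one_of_lt a.2)
  exact ⟨((g.1 : ℝ) / 2 ^ m, (g.2 : ℝ) / 2 ^ m), ⟨(key _).1, (key _).1⟩,
    Prod.ext (key _).2 (key _).2⟩

/-- Bounds the initial error by the oscillation of `f`. The condition on `f` does not control its
size, which is why the iteration starts from a sampled value instead of zero. -/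
theorem abs_sub_le_of_approx {f : ℝ × ℝ → ℝ} {m : ℕ} {h : Fin (2 ^ m) × Fin (2 ^ m) → ℝ} {η b : ℝ}
    (hη : ∀ z ∈ unitSquare, |f z - h (cell m z)| ≤ η)
    (hb : ∀ z ∈ unitSquare, ∀ w ∈ unitSquare, |f z - f w| ≤ b)
    (x y : Fin (2 ^ m) × Fin (2 ^ m)) : |h x - h y| ≤ b + 2 * η := by
  obtain ⟨z, hz, rfl⟩ := exists_cell_eq m x
  obtain ⟨w, hw, rfl⟩ := exists_cell_eq m y
  have h1 := hη z hz
  have h2 := hη w hw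
  have h3 := hb z hz w hw
  rw [abs_le] at *
  constructor <;> linarith

theorem log_two_pow_bounds {n : ℕ} (hn : 2 ≤ n) :
    (Nat.log 2 n : ℝ) ≤ 3 / 2 * Real.log n ∧ Real.log n ≤ Nat.log 2 n + 1 ∧
      (2 : ℝ) ^ Nat.log 2 n ≤ n ∧ (n : ℝ) ≤ 2 * 2 ^ Nat.log 2 n := by
  have h1 : (2 : ℝ) ^ Nat.log 2 n ≤ n := by exact_mod_cast Nat.pow_log_le_self 2 (by omega)
  have h2 : (n : ℝ) ≤ 2 * 2 ^ Nat.log 2 n := by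
    have := (Nat.lt_pow_succ_log_self (b := 2) (by norm_num) n).le
    rw [pow_succ'] at this
    exact_mod_cast this
  have hn0 : (0 : ℝ) < n := by positivity
  have e1 := Real.log_le_log (by positivity) h1
  have e2 := Real.log_le_log hn0 h2
  rw [Real.log_pow] at e1
  rw [← pow_succ', Real.log_pow] at e2
  push_cast at e2
  have l1 := Real.log_two_gt_d9
  have l2 := Real.log_two_lt_d9
  have hm : (0 : ℝ) ≤ Nat.log 2 n := by positivity
  refine ⟨by nlinarith, by nlinarith, h1, h2⟩

theorem log_lower_bound {n : ℕ} (hn : 2 ≤ n) : 69 / 100 ≤ Real.log n := by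
  have h : Real.log 2 ≤ Real.log n := Real.log_le_log (by norm_num) (by exact_mod_cast hn)
  linarith [Real.log_two_gt_d9]

theorem inv_two_pow_rpow_le {n : ℕ} (hn : 2 ≤ n) {α : ℝ} (hα : 0 ≤ α) (hα1 : α ≤ 1) :
    (((2 : ℝ) ^ Nat.log 2 n)⁻¹) ^ α ≤ 2 * (n : ℝ) ^ (-α) := by
  obtain ⟨-, -, -, h⟩ := log_two_pow_bounds hn
  have hn0 : (0 : ℝ) < n := by positivity
  have h1 : ((2 : ℝ) ^ Nat.log 2 n)⁻¹ ≤ 2 * (n : ℝ)⁻¹ := by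
    rw [inv_le_iff_one_le_mul₀ (by positivity)]
    rw [show 2 * (n : ℝ)⁻¹ * 2 ^ Nat.log 2 n = (2 * 2 ^ Nat.log 2 n) / n by ring]
    rwa [one_le_div hn0]
  calc _ ≤ (2 * (n : ℝ)⁻¹) ^ α := Real.rpow_le_rpow (by positivity) h1 hα
    _ = 2 ^ α * (n : ℝ) ^ (-α) := by
        rw [Real.mul_rpow (by norm_num) (by positivity), Real.inv_rpow hn0.le,
          Real.rpow_neg hn0.le]
    _ ≤ 2 ^ (1 : ℝ) * (n : ℝ) ^ (-α) := by
        gcongr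
        norm_num
    _ = _ := by rw [Real.rpow_one]

theorem failure_bound {c₁ c α b : ℝ} (hc₁ : 2 < c₁) (hc : 0 < c) (hα1 : α ≤ 1)
    {n k : ℕ} (hn : 2 ≤ n) (hk : c₁ * n * Real.log n ^ 2 - 1 ≤ k) (hb0 : 0 ≤ b)
    (hb : b ≤ 13 * c * Real.log n) :
    (1 - 1 / ((2 : ℝ) ^ Nat.log 2 n * (1 + Nat.log 2 n / 2))) ^ k * b ^ 2 /
      (16 * Real.exp (c₁ + 1) * c * ((n : ℝ) ^ (-α) * Real.log n ^ (3 / 2 : ℝ))) ^ 2 ≤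
      (n : ℝ) ^ (2 - c₁) := by
  obtain ⟨hm1, hm2, hp1, hp2⟩ := log_two_pow_bounds hn
  have hL := log_lower_bound hn
  set L := Real.log n
  set m := Nat.log 2 n
  have hn0 : (0 : ℝ) < n := by positivity
  have hn2 : (2 : ℝ) ≤ n := by exact_mod_cast hn
  have hr : (L ^ (3 / 2 : ℝ)) ^ 2 = L ^ 3 := by
    rw [← Real.rpow_natCast, ← Real.rpow_mul (by linarith)]
    norm_num
  have hpow1 : (1 : ℝ) ≤ 2 ^ m := one_le_pow₀ (by norm_num)
  have hm0 : (0 : ℝ) ≤ m := by positivity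
  set D : ℝ := 2 ^ m * (1 + m / 2) with hD
  have hD1 : 1 ≤ D := by rw [hD]; nlinarith
  have hDn : D ≤ n * (1 + L) := by
    rw [hD]
    apply mul_le_mul hp1 (by linarith) (by positivity) hn0.le
  have hkD : c₁ * (L - 1) - 1 ≤ k / D := by
    rw [le_div_iff₀ (by linarith)]
    rcases le_or_gt (c₁ * (L - 1) - 1) 0 with h0 | h0
    · exact (mul_nonpos_of_nonpos_of_nonneg h0 (by linarith)).trans (by positivity)
    calc (c₁ * (L - 1) - 1) * D ≤ (c₁ * (L - 1) - 1) * (n * (1 + L)) := by gcongr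
      _ = c₁ * n * L ^ 2 - c₁ * n - n * (1 + L) := by ring
      _ ≤ c₁ * n * L ^ 2 - 1 := by nlinarith
      _ ≤ k := hk
  have hexp : (1 - 1 / D) ^ k ≤ (n : ℝ) ^ (-c₁) * Real.exp (c₁ + 1) := by
    calc (1 - 1 / D) ^ k ≤ Real.exp (-(1 / D)) ^ k :=
          pow_le_pow_left₀ (sub_nonneg.2 ((div_le_one (by linarith)).2 hD1))
            (Real.one_sub_le_exp_neg _) k
      _ = Real.exp (-(k / D)) := by rw [← Real.exp_nat_mul]; congr 1; ring
      _ ≤ Real.exp (L * -c₁ + (c₁ + 1)) := by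
          apply Real.exp_le_exp.2; linarith
      _ = _ := by rw [Real.exp_add, Real.rpow_def_of_pos hn0]
  set E := Real.exp (c₁ + 1)
  have hE : 1 ≤ E := Real.one_le_exp (by linarith)
  -- The factor `n ^ 2` in the failure probability absorbs the `n ^ (2 * α)` from dividing by the
  -- squared tolerance; this needs `α ≤ 1`.
  have hq : 1 ≤ (n : ℝ) * (n : ℝ) ^ (-α) := by
    nth_rw 1 [← Real.rpow_one (n : ℝ)]
    rw [← Real.rpow_add hn0]
    exact Real.one_le_rpow (by linarith) (by linarith)
  set s := (n : ℝ) ^ (-α)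
  have hs0 : 0 < s := by positivity
  have hn2c : (n : ℝ) ^ (2 - c₁) = n ^ 2 * (n : ℝ) ^ (-c₁) := by
    rw [sub_eq_add_neg, Real.rpow_add hn0]; norm_num
  rw [hn2c, div_le_iff₀ (by positivity), mul_pow _ (s * _), mul_pow s, hr]
  have hb2 : b ^ 2 ≤ (13 * c * L) ^ 2 := pow_le_pow_left₀ hb0 hb 2
  have hq2 : 1 ≤ (n * s) ^ 2 := one_le_pow₀ hq
  calc (1 - 1 / D) ^ k * b ^ 2 ≤ ((n : ℝ) ^ (-c₁) * E) * (13 * c * L) ^ 2 := by gcongr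
    _ = ((n : ℝ) ^ (-c₁) * c ^ 2 * L ^ 2) * (169 * E * 1) := by ring
    -- The constant `16` is chosen so that `16 ^ 2 * L ≥ 256 * 0.69` exceeds `13 ^ 2 = 169`.
    _ ≤ ((n : ℝ) ^ (-c₁) * c ^ 2 * L ^ 2) * (256 * L * E ^ 2 * (n * s) ^ 2) := by
        gcongr ?_ * (?_ * ?_)
        nlinarith
    _ = _ := by ring

theorem error_bound {c₁ c α η : ℝ} (hc₁ : 2 < c₁) (hc : 0 < c) {n k : ℕ} (hn : 2 ≤ n)
    (hk : k ≤ c₁ * n * Real.log n ^ 2) (hη : η ≤ 10 * c * Real.log n * (n : ℝ) ^ (-α)) :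
    η + 16 * Real.exp (c₁ + 1) * c * ((n : ℝ) ^ (-α) * Real.log n ^ (3 / 2 : ℝ)) +
      η * √(1 + k / (2 ^ Nat.log 2 n * (1 + Nat.log 2 n / 2))) ≤
      (16 * Real.exp (c₁ + 1) + 15 + 10 * √(5 * c₁)) * c *
        ((n : ℝ) ^ (-α) * Real.log n ^ (3 / 2 : ℝ)) := by
  obtain ⟨hm1, hm2, hp1, hp2⟩ := log_two_pow_bounds hn
  have hL := log_lower_bound hn
  set L := Real.log n
  set m := Nat.log 2 n
  have hn0 : (0 : ℝ) < n := by positivity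
  have hL0 : 0 < L := by linarith
  have hr : L ^ (3 / 2 : ℝ) = L * √L := by
    rw [Real.sqrt_eq_rpow, ← Real.rpow_one_add' hL0.le (by norm_num)]; norm_num
  set s := (n : ℝ) ^ (-α)
  have hs0 : 0 < s := by positivity
  have hpow1 : (1 : ℝ) ≤ 2 ^ m := one_le_pow₀ (by norm_num)
  have hm0 : (0 : ℝ) ≤ m := by positivity
  have hsq : 2 / 3 ≤ √L := Real.le_sqrt_of_sq_le (by linarith)
  -- This lower bound on `D` keeps `k / D` of order `log n`, so the noise term gains only a factor
  -- of order `√(log n)`.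
  have hDn : n * L / 4 ≤ 2 ^ m * (1 + m / 2) := by
    calc n * L / 4 ≤ (2 * 2 ^ m) * (m + 2) / 4 := by
          gcongr; linarith
      _ = _ := by ring
  have hkD : 1 + k / (2 ^ m * (1 + m / 2)) ≤ 5 * c₁ * L := by
    have : (k : ℝ) / (2 ^ m * (1 + m / 2)) ≤ 4 * c₁ * L := by
      rw [div_le_iff₀ (by positivity)]
      calc (k : ℝ) ≤ c₁ * n * L ^ 2 := hk
        _ = 4 * c₁ * L * (n * L / 4) := by ring
        _ ≤ _ := by gcongr
    nlinarith
  have h1 : √(1 + k / (2 ^ m * (1 + m / 2))) ≤ √(5 * c₁) * √L := by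
    rw [← Real.sqrt_mul (by linarith)]
    exact Real.sqrt_le_sqrt hkD
  rw [hr]
  have e1 : η ≤ 15 * c * (s * (L * √L)) := by
    refine hη.trans ?_
    calc 10 * c * L * s = 15 * c * L * s * (2 / 3) := by ring
      _ ≤ 15 * c * L * s * √L := by gcongr
      _ = _ := by ring
  have e2 : η * √(1 + k / (2 ^ m * (1 + m / 2))) ≤ (10 * c * L * s) * (√(5 * c₁) * √L) := by
    gcongr
  linarith

/-- The estimate for Hölder exponents at most one and nontrivial parameters. -/
theorem exists_decisionTree_integral {c₁ : ℝ} (hc₁ : 2 < c₁) {n l : ℕ} (hn : 2 ≤ n)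
    (hl : c₁ * n * Real.log n ^ 2 ≤ l) :
    ∃ T : DecisionTree (Fin l × Fin 3), ∀ (c α : ℝ), 0 < c → 0 < α → α ≤ 1 →
      ∀ f : ℝ × ℝ → ℝ, MixedHolder c α f →
        ∀ (Ω : Type*) [MeasurableSpace Ω] (P : Measure Ω) [IsProbabilityMeasure P]
          (X : Fin l → Ω → ℝ × ℝ),
          (∀ i, pdf.IsUniform (X i) unitSquare P volume) → iIndepFun X P →
          1 - (n : ℝ) ^ (2 - c₁) ≤
            P.real {ω | |(∫ z in unitSquare, f z) - T.eval (sampleData f (fun i => X i ω))| ≤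
              (16 * Real.exp (c₁ + 1) + 15 + 10 * √(5 * c₁)) * c *
                ((n : ℝ) ^ (-α) * Real.log n ^ (3 / 2 : ℝ))} := by
  have hL := log_lower_bound hn
  have hn0 : (0 : ℝ) < n := by positivity
  have hpos : 0 < c₁ * n * Real.log n ^ 2 := by positivity
  -- Only `k + 1` samples are used, one for the initial guess and `k` for updates. Surplus samples
  -- are discarded because the noise bound grows with `k`.
  obtain ⟨k, hk⟩ : ∃ k, ⌈c₁ * n * Real.log n ^ 2⌉₊ = k + 1 :=
    Nat.exists_eq_succ_of_ne_zero (Nat.ceil_pos.2 hpos).ne'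
  have hkl : k + 1 ≤ l := hk ▸ Nat.ceil_le.2 hl
  have hk1 : c₁ * n * Real.log n ^ 2 - 1 ≤ k := by
    have := Nat.le_ceil (c₁ * n * Real.log n ^ 2)
    rw [hk] at this
    push_cast at this
    linarith
  have hk2 : k ≤ c₁ * n * Real.log n ^ 2 := by
    have := Nat.ceil_lt_add_one hpos.le
    rw [hk] at this
    push_cast at this
    linarith
  obtain ⟨T, hT⟩ := exists_decisionTree_kaczmarzMean (Nat.log 2 n) (Fin.castLE hkl)
  refine ⟨T, fun c α hc hα hα1 f hf Ω _ P _ X hX hind => ?_⟩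
  obtain ⟨hm1, hm2, hp1, hp2⟩ := log_two_pow_bounds hn
  have hη := fun z hz => hf.abs_sub_hyperbolicApprox_le hc.le hα.le (Nat.log 2 n) (z := z) hz
  have hdyad := inv_two_pow_rpow_le hn hα.le hα1
  have hdyad1 : (((2 : ℝ) ^ Nat.log 2 n)⁻¹) ^ α ≤ 1 :=
    Real.rpow_le_one (by positivity) (inv_le_one_of_one_le₀ (one_le_pow₀ (by norm_num))) hα.le
  set m := Nat.log 2 n
  set η : ℝ := (m + 2) * (c * (((2 : ℝ) ^ m)⁻¹) ^ α)
  have hη0 : 0 ≤ η := by positivity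
  have hη1 : η ≤ 10 * c * Real.log n * (n : ℝ) ^ (-α) := by
    calc η = (m + 2) * (c * (((2 : ℝ) ^ m)⁻¹) ^ α) := rfl
      _ ≤ (5 * Real.log n) * (c * (2 * (n : ℝ) ^ (-α))) := by
          gcongr; linarith
      _ = _ := by ring
  have hη2 : η ≤ 5 * c * Real.log n := by
    calc η = (m + 2) * (c * (((2 : ℝ) ^ m)⁻¹) ^ α) := rfl
      _ ≤ (5 * Real.log n) * (c * 1) := by
          gcongr; linarith
      _ = _ := by ring
  have hbound := abs_sub_le_of_approx hη fun z hz w hw => hf.abs_sub_le hc.le hα.le hz hw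
  set τ := 16 * Real.exp (c₁ + 1) * c * ((n : ℝ) ^ (-α) * Real.log n ^ (3 / 2 : ℝ))
  have hτ0 : 0 < τ := by
    have : 0 < Real.log n := by linarith
    positivity
  have hfail := failure_bound hc₁ hc hα1 hn hk1 (b := 2 * c + 2 * η) (by positivity)
    (by nlinarith)
  have hprob := one_sub_le_measureReal_initialError_le m (X := fun i => X (Fin.castLE hkl i))
    (fun i => hX _) (hind.precomp (Fin.castLE_injective hkl))
    (hyperbolicApprox_reproduces f m) hbound (pow_pos hτ0 2)
  refine (sub_le_sub_left hfail 1).trans (hprob.trans (measureReal_mono ?_))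
  rintro ω ⟨hsq, hms⟩
  rw [Set.mem_ofPred_eq, hT]
  have herr := abs_setIntegral_sub_kaczmarzMean_le (hf.integrableOn hα) hη hsq
  have hsqrt := Real.sqrt_le_sqrt hms
  rw [Real.sqrt_sq hτ0.le] at hsqrt
  refine le_trans herr (le_trans ?_ (error_bound hc₁ hc hn hk2 hη1))
  gcongr

end Main

theorem corollary1 (c₁ : ℝ) (hc₁ : 0 < c₁) :
    ∃ C : ℝ → ℝ, ∀ n l : ℕ, 1 ≤ n → c₁ * n * Real.log n ^ 2 ≤ l →
      ∃ T : DecisionTree (Fin l × Fin 3),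
        ∀ (c α : ℝ), 0 < c → 0 < α → ∀ f : ℝ × ℝ → ℝ, MixedHolder c α f →
          IntegrableOn f unitSquare ∧
          ∀ (Ω : Type*) [MeasurableSpace Ω] (P : Measure Ω) [IsProbabilityMeasure P]
            (X : Fin l → Ω → ℝ × ℝ),
            (∀ i, pdf.IsUniform (X i) unitSquare P volume) → iIndepFun X P →
            1 - (n : ℝ) ^ (2 - c₁) ≤
              P.real {ω | |(∫ z in unitSquare, f z) - T.eval (sampleData f (fun i => X i ω))| ≤
                C c * ((n : ℝ) ^ (-α) * Real.log n ^ (3 / 2 : ℝ))} := by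
  -- Linearity of this constant in `c` is what the case `α > 1` relies on.
  refine ⟨fun c => (16 * Real.exp (c₁ + 1) + 15 + 10 * √(5 * c₁)) * c, fun n l hn hl => ?_⟩
  -- If `c₁ ≤ 2` or `n = 1`, the claimed probability is at most zero and any tree will do.
  by_cases htriv : (1 : ℝ) ≤ (n : ℝ) ^ (2 - c₁)
  · exact ⟨.output 0, fun c α _ hα f hf => ⟨hf.integrableOn hα, fun Ω _ P _ X _ _ =>
      (sub_nonpos.2 htriv).trans measureReal_nonneg⟩⟩
  have hn1 : (1 : ℝ) ≤ n := by exact_mod_cast hn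
  have hc₁2 : 2 < c₁ := by
    by_contra h
    exact htriv (Real.one_le_rpow hn1 (by linarith))
  have hn2 : 2 ≤ n := by
    by_contra h
    obtain rfl : n = 1 := by omega
    simp at htriv
  have hn0 : (0 : ℝ) < n := by linarith
  obtain ⟨T, hT⟩ := exists_decisionTree_integral hc₁2 hn2 hl
  refine ⟨T, fun c α hc hα f hf => ⟨hf.integrableOn hα, fun Ω _ P _ X hX hind => ?_⟩⟩
  rcases le_or_gt α 1 with hα1 | hα1
  · exact hT c α hc hα hα1 f hf Ω P X hX hind
  -- The tree does not depend on the parameters, so it may be used with exponent `1` and constant `c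
  -- * n ^ (1 - α)`; the resulting bound is exactly the one wanted for `c` and `α`.
  · have hc' : 0 < c * (n : ℝ) ^ (1 - α) := by positivity
    have := hT _ 1 hc' one_pos le_rfl f (hf.of_exponent_gt_one hα1 hc'.le) Ω P X hX hind
    have e : (n : ℝ) ^ (-α) = (n : ℝ) ^ (1 - α) * (n : ℝ) ^ (-1 : ℝ) := by
      rw [← Real.rpow_add hn0]; congr 1; ring
    convert this using 5
    rw [e]
    ring
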